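/- Let $M$ be a finitely presented special monoid, that is, a monoid isomorphic to one defined by a finite presentation $\langle A \mid w_1=1,\ldots,w_k=1\rangle$ with $A$ a finite set and $w_1,\ldots,w_k$ words over $A$. Then every right ideal of $M$ (a subset $I\subseteq M$ with $IM\subseteq I$) is a free right $M$-set, and every left ideal of $M$ (a subset $I\subseteq M$ with $MI\subseteq I$) is a free left $M$-set. In particular, every projective left $M$-set is a free left $M$-set and every projective right $M$-set is a free right $M$-set. Here a left $M$-set $X$ is free if it has a subset $B$ such that each element of $X$ can be uniquely expressed as $mb$ with $m\in M$ and $b\in B$, and a left $M$-set $P$ is projective if every $M$-equivariant surjective map $f\colon X\to P$ from a left $M$-set $X$ has an $M$-equivariant section $s\colon P\to X$, $f\circ s=1_P$; the notions for right $M$-sets are dual. -/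

import Mathlib

universe u v

/-- The monoid defined by the special presentation `⟨A ∣ w = 1 (w ∈ W)⟩`. -/
abbrev SpecialPresentedMonoid {A : Type*} (W : Set (FreeMonoid A)) : Type _ :=
  PresentedMonoid (fun l r : FreeMonoid A => l ∈ W ∧ r = 1)

/-- `M` is a finitely presented special monoid: it is isomorphic to the monoid defined by some
finite presentation `⟨A ∣ w₁ = 1, …, wₖ = 1⟩`. (A finite alphabet may be taken to be `Fin n`.) -/
def IsFPSpecialMonoid (M : Type u) [Monoid M] : Prop :=
  ∃ (n : ℕ) (W : Set (FreeMonoid (Fin n))), W.Finite ∧ Nonempty (SpecialPresentedMonoid W ≃* M)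

/-- A subset `B` of a (left) `M`-set `X` is a free basis if each element of `X` can be uniquely
expressed as `m • b` with `m ∈ M` and `b ∈ B`. -/
def IsFreeBasis (M : Type u) [Monoid M] {X : Type v} [MulAction M X] (B : Set X) : Prop :=
  ∀ x : X, ∃! p : M × B, p.1 • (p.2 : X) = x

/-- A (left) `M`-set is free if it has a free basis. A right `M`-set is a left `Mᵐᵒᵖ`-set. -/
def IsFreeMSet (M : Type u) [Monoid M] (X : Type v) [MulAction M X] : Prop :=
  ∃ B : Set X, IsFreeBasis M B

/-- A (left) `M`-set `P` is projective if every `M`-equivariant surjection onto `P` has an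
`M`-equivariant section. The universe `max u v` contains the free `M`-set on `P`. -/
def IsProjectiveMSet (M : Type u) [Monoid M] (P : Type v) [MulAction M P] : Prop :=
  ∀ (X : Type (max u v)) [MulAction M X] (f : X →[M] P), Function.Surjective f →
    ∃ s : P →[M] X, ∀ p : P, f (s p) = p

/-! Rewrite words by replacing a factor that represents a unit with a shortlex-smaller word for the
same unit. Overlaps of such factors again represent units, so rewriting is confluent and each
element has one reduced word. Split it as `p * c` with `p` left invertible and `c` without nonempty
left invertible prefixes: `c` generates the same left ideal. Multiplying such a `c` on the left by a
reduced word gives a reduced word, so equations `n * c = n' * c'` become equations of words: these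
principal ideals are free, and two that meet are nested because one word is a suffix of the other. A
left ideal is thus the disjoint union of its maximal ones. A section embeds a projective set in a
free one, with left ideals as components. Reversing words gives the right-handed case. -/

open Relation MulOpposite

/-! ### Free actions -/

section Actions

variable {N : Type u} [Monoid N]

/-- All left ideals of `N` are free provided that `N` is covered, up to mutual divisibility, by
elements that generate free left ideals which are pairwise comparable or disjoint, and the
divisibility among those elements is controlled by a length. -/
theorem isFreeMSet_of_generators {K : Type*} (g : K → N) (len : K → ℕ)
    (cover : ∀ x, ∃ k, (∃ n, x = n * g k) ∧ ∃ n, g k = n * x)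
    (comparable : ∀ k k' n n', n * g k = n' * g k' →
      (∃ m, g k = m * g k') ∨ ∃ m, g k' = m * g k)
    (cancel : ∀ k n n', n * g k = n' * g k → n = n')
    (length_lt : ∀ k k' m, g k = m * g k' → k = k' ∨ len k' < len k)
    (I : SubMulAction N N) : IsFreeMSet N I := by
  -- The basis: generators in `I` whose principal left ideals are maximal in `I`. They exist because
  -- proper division lowers `len`.
  refine ⟨{b | ∃ k, g k = b ∧ ∀ k', g k' ∈ I → (∃ m, g k = m * g k') → k = k'}, fun x ↦ ?_⟩
  have hex : ∃ l k, len k = l ∧ g k ∈ I ∧ ∃ n, (x : N) = n * g k := by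
    obtain ⟨k, hx, n, hn⟩ := cover x
    exact ⟨_, k, rfl, hn ▸ I.smul_mem n x.2, hx⟩
  classical
  obtain ⟨k, hk, hkI, n, hn⟩ := Nat.find_spec hex
  have hmin : ∀ k', g k' ∈ I → (∃ m, g k = m * g k') → k = k' := by
    rintro k' hk' ⟨m, hm⟩
    refine (length_lt _ _ m hm).resolve_right fun hlt ↦ ?_
    exact Nat.find_min hex (hk ▸ hlt) ⟨k', rfl, hk', n * m, by rw [hn, hm, mul_assoc]⟩
  refine ⟨(n, ⟨⟨g k, hkI⟩, k, rfl, hmin⟩), Subtype.ext hn.symm, ?_⟩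
  rintro ⟨n', ⟨⟨y, hkI'⟩, k', hy, hmin'⟩⟩ h
  change g k' = y at hy
  subst hy
  have h' : n' * g k' = n * g k := (congrArg Subtype.val h).trans hn
  obtain rfl : k' = k := by
    rcases comparable _ _ _ _ h' with hm | hm
    · exact hmin' _ hkI hm
    · exact (hmin _ hkI' hm).symm
  obtain rfl := cancel _ _ _ h'
  rfl

/-- Freeness of actions is invariant under equivariant bijections. -/
theorem IsFreeMSet.of_equiv {X : Type*} {Y : Type*} [MulAction N X] [MulAction N Y]
    (e : X ≃ Y) (he : ∀ (n : N) (x : X), e (n • x) = n • e x) (h : IsFreeMSet N X) :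
    IsFreeMSet N Y := by
  obtain ⟨B, hB⟩ := h
  refine ⟨e '' B, fun y ↦ ?_⟩
  obtain ⟨⟨n, b⟩, hb, huniq⟩ := hB (e.symm y)
  refine ⟨(n, ⟨e b, b, b.2, rfl⟩), ?_, ?_⟩
  · change n • e (b : X) = y
    rw [← he, hb, e.apply_symm_apply]
  · rintro ⟨n', ⟨_, b', hb', rfl⟩⟩ h
    have := huniq (n', ⟨b', hb'⟩) (e.injective <| by
      rw [e.apply_symm_apply, ← h]; exact he _ _)
    cases this
    rfl

/-- The free left `N`-set with basis indexed by `P`. -/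
@[ext]
structure FreeNSet (N : Type u) (P : Type v) : Type (max u v) where
  coeff : N
  base : P

instance (P : Type v) : MulAction N (FreeNSet N P) where
  smul n x := ⟨n * x.coeff, x.base⟩
  one_smul _ := FreeNSet.ext (one_mul _) rfl
  mul_smul m n x := FreeNSet.ext (mul_assoc m n x.coeff) rfl

/-- If all left ideals of `N` are free then so are all projective left `N`-sets. -/
theorem IsProjectiveMSet.isFreeMSet (hN : ∀ I : SubMulAction N N, IsFreeMSet N I)
    {P : Type v} [MulAction N P] (hP : IsProjectiveMSet N P) : IsFreeMSet N P := by
  let f : FreeNSet N P →[N] P :=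
    { toFun := fun x ↦ x.coeff • x.base
      map_smul' := fun m x ↦ mul_smul m x.coeff x.base }
  obtain ⟨s, hs⟩ := hP _ f fun p ↦ ⟨⟨1, p⟩, one_smul N p⟩
  have hcoeff (n : N) (p : P) : (s (n • p)).coeff = n * (s p).coeff :=
    congrArg FreeNSet.coeff (s.map_smul n p)
  have hbase (n : N) (p : P) : (s (n • p)).base = (s p).base :=
    (congrArg FreeNSet.base (s.map_smul n p)).trans rfl
  have hinj {p q : P} (h₁ : (s p).coeff = (s q).coeff) (h₂ : (s p).base = (s q).base) :
      p = q := by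
    rw [← hs p, FreeNSet.ext h₁ h₂, hs]
  -- Coefficients of the part of `s(P)` lying over `p`; the bases of these left ideals assemble into
  -- one of `P`.
  let I (p : P) : SubMulAction N N :=
    { carrier := {n | ∃ x, (s x).coeff = n ∧ (s x).base = p}
      smul_mem' := by
        rintro m _ ⟨x, rfl, hx⟩
        exact ⟨m • x, hcoeff m x, (hbase m x).trans hx⟩ }
  choose B hB using fun p ↦ hN (I p)
  refine ⟨{x | ∃ b ∈ B (s x).base, (s x).coeff = b.1}, fun x ↦ ?_⟩
  obtain ⟨⟨n, b, hb⟩, hn, huniq⟩ := hB (s x).base ⟨(s x).coeff, x, rfl, rfl⟩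
  obtain ⟨y, hy₁, hy₂⟩ := b.2
  have hn' : n * b.1 = (s x).coeff := congrArg Subtype.val hn
  have hy : ∃ c ∈ B (s y).base, (s y).coeff = c.1 := by
    rw [hy₂]
    exact ⟨b, hb, hy₁⟩
  refine ⟨(n, ⟨y, hy⟩), hinj ?_ ((hbase n y).trans hy₂), ?_⟩
  · exact (hcoeff n y).trans (by rw [hy₁, hn'])
  · rintro ⟨n', ⟨y', hy'⟩⟩ h
    change n' • y' = x at h
    have h₁ : n' * (s y').coeff = (s x).coeff := by rw [← hcoeff, h]
    have h₂ : (s y').base = (s x).base := by rw [← hbase n' y', h]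
    change ∃ c ∈ B (s y').base, (s y').coeff = c.1 at hy'
    have hmem := hy'
    rw [h₂] at hmem
    obtain ⟨c, hc, hyc⟩ := hmem
    have := huniq (n', ⟨c, hc⟩) (Subtype.ext ((congrArg (n' * ·) hyc).symm.trans h₁))
    cases this
    obtain rfl : y' = y := hinj (hyc.trans hy₁.symm) (h₂.trans hy₂.symm)
    rfl

end Actions

/-! ### The shortlex order -/

theorem List.Lex.append_right_of_length_eq {α : Type*} {r : α → α → Prop} {l₁ l₂ : List α}
    (h : List.Lex r l₁ l₂) (hlen : l₁.length = l₂.length) (t : List α) :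
    List.Lex r (l₁ ++ t) (l₂ ++ t) := by
  induction h with
  | nil => simp at hlen
  | cons _ ih => exact .cons (ih (by simpa using hlen))
  | rel h => exact .rel h

theorem List.Shortlex.append_append {α : Type*} {r : α → α → Prop} {l₁ l₂ : List α}
    (h : List.Shortlex r l₁ l₂) (s t : List α) :
    List.Shortlex r (s ++ l₁ ++ t) (s ++ l₂ ++ t) := by
  have h' := h.append_left s
  rcases List.shortlex_def.1 h' with h₁ | ⟨h₁, h₂⟩
  · exact .of_length_lt (by simp only [List.length_append] at h₁ ⊢; omega)
  · exact .of_lex (by simp only [List.length_append] at h₁ ⊢; omega)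
      (h₂.append_right_of_length_eq h₁ t)

theorem FreeMonoid.mul_eq_mul_iff {A : Type*} {a b c d : FreeMonoid A} :
    a * b = c * d ↔ (∃ e, c = a * e ∧ b = e * d) ∨ ∃ e, a = c * e ∧ d = e * b :=
  List.append_eq_append_iff

/-! ### Special presentations -/

/-- A surjection from a free monoid whose kernel is generated, as a congruence, by pairs
`(w, 1)`. -/
def IsSpecialPresentation {A M : Type*} [Monoid M] (φ : FreeMonoid A →* M) : Prop :=
  Function.Surjective φ ∧
    ∀ c : Con (FreeMonoid A), (∀ w, φ w = 1 → c w 1) → ∀ a b, φ a = φ b → c a b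

theorem IsFPSpecialMonoid.exists_isSpecialPresentation {M : Type u} [Monoid M]
    (h : IsFPSpecialMonoid M) :
    ∃ (n : ℕ) (φ : FreeMonoid (Fin n) →* M), IsSpecialPresentation φ := by
  obtain ⟨n, W, -, ⟨e⟩⟩ := h
  refine ⟨n, e.toMonoidHom.comp (PresentedMonoid.mk _),
    e.surjective.comp PresentedMonoid.surjective_mk, fun c hc a b hab ↦ ?_⟩
  have hab' := PresentedMonoid.mk_eq_mk_iff.1 (e.injective hab)
  refine Con.conGen_le.2 ?_ hab'
  rintro w _ ⟨hw, rfl⟩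
  refine hc w ?_
  exact (congrArg e (PresentedMonoid.mk_eq_mk_of_rel ⟨hw, rfl⟩)).trans (by simp)

theorem FreeMonoid.lift_op_apply {A M : Type*} [Monoid M] (φ : FreeMonoid A →* M)
    (w : FreeMonoid A) :
    FreeMonoid.lift (fun a ↦ op (φ (.of a))) w = op (φ w.reverse) := by
  induction w using FreeMonoid.inductionOn' with
  | one => simp [show (1 : FreeMonoid A).reverse = 1 from rfl]
  | of_mul a w ih => simp [ih, FreeMonoid.reverse_mul]

/-- Reversal is an anti-automorphism of the free monoid and fixes 1, so relators go to relators. -/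
theorem IsSpecialPresentation.opposite {A M : Type*} [Monoid M] {φ : FreeMonoid A →* M}
    (h : IsSpecialPresentation φ) :
    IsSpecialPresentation (FreeMonoid.lift fun a ↦ op (φ (.of a))) := by
  refine ⟨fun m ↦ ?_, fun c hc a b hab ↦ ?_⟩
  · obtain ⟨w, hw⟩ := h.1 m.unop
    exact ⟨w.reverse, by rw [FreeMonoid.lift_op_apply, FreeMonoid.reverse_reverse, hw, op_unop]⟩
  · simp only [FreeMonoid.lift_op_apply] at hc hab
    replace hab := op_injective hab
    let c' : Con (FreeMonoid A) :=
      { r := fun a b ↦ c a.reverse b.reverse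
        iseqv := ⟨fun _ ↦ c.refl _, c.symm, c.trans⟩
        mul' := fun h₁ h₂ ↦ by
          simp only [FreeMonoid.reverse_mul]
          exact c.mul h₂ h₁ }
    have : c' a.reverse b.reverse :=
      h.2 c' (fun w hw ↦ hc w.reverse (by
        rw [FreeMonoid.reverse_reverse, hw, op_one])) _ _ hab
    change c a.reverse.reverse b.reverse.reverse at this
    rwa [FreeMonoid.reverse_reverse, FreeMonoid.reverse_reverse] at this

/-! ### Rewriting words that represent units -/

/-- Every word splits as a left invertible prefix and a word without nonempty left invertible
prefixes. -/
theorem exists_eq_mul_no_left_invertible_prefix {A M : Type*} [Monoid M]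
    (φ : FreeMonoid A →* M) (w : FreeMonoid A) :
    ∃ p c, w = p * c ∧ (∃ l, l * φ p = 1) ∧
      ∀ d t, c = d * t → (∃ l, l * φ d = 1) → d = 1 := by
  induction hn : w.length using Nat.strong_induction_on generalizing w with
  | _ n ih =>
    by_cases h : ∀ d t, w = d * t → (∃ l, l * φ d = 1) → d = 1
    · exact ⟨1, w, (one_mul w).symm, ⟨1, by simp⟩, h⟩
    · push Not at h
      obtain ⟨d, t, rfl, ⟨l, hl⟩, hd⟩ := h
      have hpos : d.length ≠ 0 := fun h ↦ hd (FreeMonoid.length_eq_zero.1 h)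
      obtain ⟨p, c, rfl, ⟨l', hl'⟩, hc⟩ := ih t.length
        (by rw [← hn, FreeMonoid.length_mul]; omega) t rfl
      refine ⟨d * p, c, (mul_assoc ..).symm, ⟨l' * l, ?_⟩, hc⟩
      rw [map_mul, mul_assoc, ← mul_assoc l, hl, one_mul, hl']

section Rewriting

variable {A M : Type*} [LinearOrder A] [Monoid M]

/-- The overlap `b` has a left and a right inverse, so it is a unit and cancels. -/
theorem isUnit_of_isUnit_mul_of_isUnit_mul {a b c : M} (hab : IsUnit (a * b))
    (hbc : IsUnit (b * c)) : IsUnit c := by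
  obtain ⟨l, hl⟩ := hab.exists_left_inv
  obtain ⟨r, hr⟩ := hbc.exists_right_inv
  have hl' : l * a * b = 1 := by rw [mul_assoc, hl]
  have hr' : b * (c * r) = 1 := by rw [← mul_assoc, hr]
  have heq := left_inv_eq_right_inv hl' hr'
  have hb : IsUnit b := ⟨⟨b, l * a, by rw [heq, hr'], hl'⟩, rfl⟩
  obtain ⟨v, rfl⟩ := hb
  exact (Units.isUnit_units_mul v c).1 hbc

/-- One rewriting step: a factor representing a unit is replaced by a shortlex smaller word
representing the same unit. -/
def UnitStep (φ : FreeMonoid A →* M) (a b : FreeMonoid A) : Prop :=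
  ∃ s u v t, a = s * u * t ∧ b = s * v * t ∧ φ u = φ v ∧ IsUnit (φ u) ∧
    List.Shortlex (· < ·) v.toList u.toList

/-- A word to which no rewriting step applies. -/
def UnitReduced (φ : FreeMonoid A →* M) (a : FreeMonoid A) : Prop :=
  ∀ b, ¬ UnitStep φ a b

namespace UnitStep

variable {φ : FreeMonoid A →* M} {a b : FreeMonoid A}

theorem map_eq (h : UnitStep φ a b) : φ a = φ b := by
  obtain ⟨s, u, v, t, rfl, rfl, huv, -⟩ := h
  simp [huv]

theorem shortlex (h : UnitStep φ a b) : List.Shortlex (· < ·) b.toList a.toList := by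
  obtain ⟨s, u, v, t, rfl, rfl, -, -, h⟩ := h
  exact h.append_append s.toList t.toList

theorem mul_mul (h : UnitStep φ a b) (x y : FreeMonoid A) :
    UnitStep φ (x * a * y) (x * b * y) := by
  obtain ⟨s, u, v, t, rfl, rfl, h⟩ := h
  exact ⟨x * s, u, v, t * y, by simp only [mul_assoc], by simp only [mul_assoc], h⟩

/-- Shortlex is total, so the larger word rewrites to the smaller in one step. -/
theorem join_of_isUnit {x y : FreeMonoid A} (hxy : φ x = φ y) (hx : IsUnit (φ x))
    (s t : FreeMonoid A) :
    ∃ d, ReflGen (UnitStep φ) (s * x * t) d ∧ ReflGen (UnitStep φ) (s * y * t) d := by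
  by_cases h₁ : List.Shortlex (· < ·) x.toList y.toList
  · exact ⟨_, .refl, .single ⟨s, y, x, t, rfl, rfl, hxy.symm, hxy ▸ hx, h₁⟩⟩
  by_cases h₂ : List.Shortlex (· < ·) y.toList x.toList
  · exact ⟨_, .single ⟨s, x, y, t, rfl, rfl, hxy, hx, h₂⟩, .refl⟩
  obtain rfl : x = y := Std.Trichotomous.trichotomous (r := List.Shortlex (· < ·)) _ _ h₁ h₂
  exact ⟨_, .refl, .refl⟩

/-- The factor `u` starts no later than `u'`: they are disjoint, nested or properly overlapping. -/
theorem join_of_le {s e u v t u' v' t' : FreeMonoid A} (hv : φ u = φ v) (hu : IsUnit (φ u))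
    (hlt : List.Shortlex (· < ·) v.toList u.toList) (hv' : φ u' = φ v') (hu' : IsUnit (φ u'))
    (hlt' : List.Shortlex (· < ·) v'.toList u'.toList) (h : u * t = e * (u' * t')) :
    ∃ d, ReflGen (UnitStep φ) (s * v * t) d ∧ ReflGen (UnitStep φ) (s * e * v' * t') d := by
  rcases FreeMonoid.mul_eq_mul_iff.1 h with ⟨d, rfl, rfl⟩ | ⟨d, rfl, hd⟩
  · refine ⟨s * v * d * v' * t', .single ?_, .single ?_⟩
    · exact ⟨s * v * d, u', v', t', by simp only [mul_assoc], rfl, hv', hu', hlt'⟩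
    · exact ⟨s, u, v, d * v' * t', by simp only [mul_assoc], by simp only [mul_assoc],
        hv, hu, hlt⟩
  · rcases FreeMonoid.mul_eq_mul_iff.1 hd with ⟨f, rfl, rfl⟩ | ⟨f, rfl, rfl⟩
    · have := join_of_isUnit (φ := φ) (x := v) (y := e * v' * f)
        (by simp [← hv, ← hv', mul_assoc]) (hv ▸ hu) s t
      simpa only [mul_assoc] using this
    -- Here `u = e * d` and `u' = d * f`; the union `e * d * f` also represents a unit.
    · rw [map_mul] at hu hu'
      have hf := isUnit_of_isUnit_mul_of_isUnit_mul hu hu'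
      have := join_of_isUnit (φ := φ) (x := v * f) (y := e * v')
        (by simp [← hv, ← hv', mul_assoc])
        (by rw [map_mul, ← hv, map_mul]; exact hu.mul hf) s t'
      simpa only [mul_assoc] using this

theorem diamond {a b c : FreeMonoid A} (hb : UnitStep φ a b) (hc : UnitStep φ a c) :
    ∃ d, ReflGen (UnitStep φ) b d ∧ ReflGen (UnitStep φ) c d := by
  obtain ⟨s, u, v, t, rfl, rfl, hv, hu, hlt⟩ := hb
  obtain ⟨s', u', v', t', h, rfl, hv', hu', hlt'⟩ := hc
  rw [mul_assoc, mul_assoc] at h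
  rcases FreeMonoid.mul_eq_mul_iff.1 h with ⟨e, rfl, he⟩ | ⟨e, rfl, he⟩
  · exact join_of_le hv hu hlt hv' hu' hlt' he
  · obtain ⟨d, h₁, h₂⟩ := join_of_le (s := s') hv' hu' hlt' hv hu hlt he
    exact ⟨d, h₂, h₁⟩

variable (φ) in
theorem equivalence_join : Equivalence (Join (ReflTransGen (UnitStep φ))) :=
  equivalence_join_reflTransGen fun _ _ _ hb hc ↦
    let ⟨d, h₁, h₂⟩ := hb.diamond hc
    ⟨d, h₁, h₂.to_reflTransGen⟩

theorem reflTransGen_mul {a b c d : FreeMonoid A} (h₁ : ReflTransGen (UnitStep φ) a b)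
    (h₂ : ReflTransGen (UnitStep φ) c d) : ReflTransGen (UnitStep φ) (a * c) (b * d) := by
  refine (h₁.lift (· * c) fun _ _ h ↦ ?_).trans (h₂.lift (b * ·) fun _ _ h ↦ ?_)
  · simpa using h.mul_mul 1 c
  · simpa using h.mul_mul b 1

/-- By confluence joinability is a congruence, and it contains the defining pairs since 1 is a unit.
-/
theorem join_of_map_eq (hφ : IsSpecialPresentation φ) (h : φ a = φ b) :
    Join (ReflTransGen (UnitStep φ)) a b := by
  let c : Con (FreeMonoid A) :=
    { r := Join (ReflTransGen (UnitStep φ))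
      iseqv := equivalence_join φ
      mul' := fun ⟨x, h₁, h₂⟩ ⟨y, h₃, h₄⟩ ↦
        ⟨x * y, reflTransGen_mul h₁ h₃, reflTransGen_mul h₂ h₄⟩ }
  refine hφ.2 c (fun w hw ↦ ?_) _ _ h
  obtain ⟨d, h₁, h₂⟩ := join_of_isUnit (φ := φ) (x := w) (y := 1) (by simp [hw])
    (by simp [hw]) 1 1
  simp only [one_mul, mul_one] at h₁ h₂
  exact ⟨d, h₁.to_reflTransGen, h₂.to_reflTransGen⟩

end UnitStep

namespace UnitReduced

variable {φ : FreeMonoid A →* M} {p c : FreeMonoid A}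

theorem eq_of_map_eq (hφ : IsSpecialPresentation φ) {a b : FreeMonoid A} (ha : UnitReduced φ a)
    (hb : UnitReduced φ b) (h : φ a = φ b) : a = b := by
  obtain ⟨d, h₁, h₂⟩ := UnitStep.join_of_map_eq hφ h
  rw [reflTransGen_iff_eq ha] at h₁
  rw [reflTransGen_iff_eq hb] at h₂
  exact h₁.symm.trans h₂

/-- The shortlex-least representative works, as steps strictly decrease. -/
theorem exists_map_eq [WellFoundedLT A] (hφ : IsSpecialPresentation φ) (m : M) :
    ∃ w, UnitReduced φ w ∧ φ w = m := by
  have wf : WellFounded fun a b : FreeMonoid A ↦ List.Shortlex (· < ·) a.toList b.toList :=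
    List.Shortlex.wf wellFounded_lt
  obtain ⟨w, hw, hmin⟩ := wf.has_min {w | φ w = m} (hφ.1 m)
  exact ⟨w, fun b h ↦ hmin b (h.map_eq.symm.trans hw) h.shortlex, hw⟩

theorem of_mul_right (h : UnitReduced φ (p * c)) : UnitReduced φ c :=
  fun b hb ↦ h (p * b) (by simpa using hb.mul_mul p 1)

/-- Multiplying on the left by a reduced word preserves reducedness of a word without nonempty
left invertible prefixes. -/
theorem mul (hp : UnitReduced φ p) (hc : UnitReduced φ c)
    (hpre : ∀ d t, c = d * t → (∃ l, l * φ d = 1) → d = 1) : UnitReduced φ (p * c) := by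
  rintro _ ⟨s, u, v, t, h, rfl, hv, hu, hlt⟩
  rw [mul_assoc] at h
  rcases FreeMonoid.mul_eq_mul_iff.1 h with ⟨e, rfl, rfl⟩ | ⟨e, rfl, he⟩
  · exact hc _ ⟨e, u, v, t, (mul_assoc ..).symm, rfl, hv, hu, hlt⟩
  · rcases FreeMonoid.mul_eq_mul_iff.1 he with ⟨d, rfl, rfl⟩ | ⟨d, rfl, rfl⟩
    · exact hp _ ⟨s, u, v, d, (mul_assoc ..).symm, rfl, hv, hu, hlt⟩
    -- The factor `e * d` straddles the boundary, so `d` is a left invertible prefix of `c`, hence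
    -- empty.
    · obtain ⟨l, hl⟩ := hu.exists_left_inv
      obtain rfl := hpre d t rfl ⟨l * φ e, by rw [mul_assoc, ← map_mul, hl]⟩
      rw [mul_one] at hv hu hlt
      exact hp _ ⟨s, e, v, 1, by simp, rfl, hv, hu, hlt⟩

end UnitReduced

/-- Every left ideal of a monoid with a special presentation is free. -/
theorem IsSpecialPresentation.isFreeMSet_leftIdeal [WellFoundedLT A] {N : Type u} [Monoid N]
    {φ : FreeMonoid A →* N} (hφ : IsSpecialPresentation φ) (I : SubMulAction N N) :
    IsFreeMSet N I := by
  let K := {c : FreeMonoid A // UnitReduced φ c ∧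
    ∀ d t, c = d * t → (∃ l, l * φ d = 1) → d = 1}
  have key : ∀ (k k' : K) (p p' : FreeMonoid A), UnitReduced φ p → UnitReduced φ p' →
      φ p * φ k = φ p' * φ k' → p * k = p' * k' := fun k k' p p' hp hp' h ↦
    (hp.mul k.2.1 k.2.2).eq_of_map_eq hφ (hp'.mul k'.2.1 k'.2.2) (by simpa using h)
  have one : UnitReduced φ 1 := by
    obtain ⟨w, hw, -⟩ := UnitReduced.exists_map_eq hφ 1
    exact UnitReduced.of_mul_right (p := w) (by rwa [mul_one])
  refine isFreeMSet_of_generators (fun k : K ↦ φ k) (fun k ↦ k.1.length)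
    (fun x ↦ ?_) (fun k k' n n' h ↦ ?_) (fun k n n' h ↦ ?_) (fun k k' m h ↦ ?_) I
  · obtain ⟨w, hw, rfl⟩ := UnitReduced.exists_map_eq hφ x
    obtain ⟨p, c, rfl, ⟨l, hl⟩, hc⟩ := exists_eq_mul_no_left_invertible_prefix φ w
    refine ⟨⟨c, hw.of_mul_right, hc⟩, ⟨φ p, map_mul ..⟩, l, ?_⟩
    rw [map_mul, ← mul_assoc, hl, one_mul]
  · obtain ⟨p, hp, rfl⟩ := UnitReduced.exists_map_eq hφ n
    obtain ⟨p', hp', rfl⟩ := UnitReduced.exists_map_eq hφ n'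
    rcases FreeMonoid.mul_eq_mul_iff.1 (key k k' p p' hp hp' h) with ⟨e, -, he⟩ | ⟨e, -, he⟩
    · exact .inl ⟨φ e, by rw [he, map_mul]⟩
    · exact .inr ⟨φ e, by rw [he, map_mul]⟩
  · obtain ⟨p, hp, rfl⟩ := UnitReduced.exists_map_eq hφ n
    obtain ⟨p', hp', rfl⟩ := UnitReduced.exists_map_eq hφ n'
    rw [mul_right_cancel (key k k p p' hp hp' h)]
  · obtain ⟨p, hp, rfl⟩ := UnitReduced.exists_map_eq hφ m
    have h' := key k k' 1 p one hp (by simpa using h)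
    rw [one_mul] at h'
    by_cases hp1 : p = 1
    · exact .inl (Subtype.ext (by rw [h', hp1, one_mul]))
    · have hpos : p.length ≠ 0 := fun h ↦ hp1 (FreeMonoid.length_eq_zero.1 h)
      right
      rw [h', FreeMonoid.length_mul]
      omega

end Rewriting

/-- If all left ideals of `Mᵐᵒᵖ` are free then all right ideals of `M` are free. -/
theorem isFreeMSet_rightIdeal {M : Type u} [Monoid M]
    (h : ∀ J : SubMulAction Mᵐᵒᵖ Mᵐᵒᵖ, IsFreeMSet Mᵐᵒᵖ J) (I : SubMulAction Mᵐᵒᵖ M) :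
    IsFreeMSet Mᵐᵒᵖ I := by
  let J : SubMulAction Mᵐᵒᵖ Mᵐᵒᵖ :=
    { carrier := {x | x.unop ∈ I}
      smul_mem' := fun m _ hx ↦ I.smul_mem m hx }
  exact (h J).of_equiv
    { toFun := fun x ↦ ⟨x.1.unop, x.2⟩
      invFun := fun x ↦ ⟨MulOpposite.op x.1, x.2⟩
      left_inv := fun _ ↦ rfl
      right_inv := fun _ ↦ rfl } fun _ _ ↦ rfl

/-- Right `M`-sets are `Mᵐᵒᵖ`-sets, with `MulOpposite.op m • x` standing for `x m`; so right ideals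
of `M` are `SubMulAction Mᵐᵒᵖ M` and left ideals are `SubMulAction M M`. -/
theorem theoremt (M : Type u) [Monoid M] (hM : IsFPSpecialMonoid M) :
    (∀ I : SubMulAction Mᵐᵒᵖ M, IsFreeMSet Mᵐᵒᵖ I) ∧
    (∀ I : SubMulAction M M, IsFreeMSet M I) ∧
    (∀ (P : Type v) [MulAction M P], IsProjectiveMSet M P → IsFreeMSet M P) ∧
    (∀ (P : Type v) [MulAction Mᵐᵒᵖ P], IsProjectiveMSet Mᵐᵒᵖ P → IsFreeMSet Mᵐᵒᵖ P) := by
  obtain ⟨n, φ, hφ⟩ := hM.exists_isSpecialPresentation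
  have left := hφ.isFreeMSet_leftIdeal
  have right := hφ.opposite.isFreeMSet_leftIdeal
  exact ⟨isFreeMSet_rightIdeal right, left, fun P _ hP ↦ hP.isFreeMSet left,
    fun P _ hP ↦ hP.isFreeMSet right⟩
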